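/- **Theorem 2.** Call a sequence $\{a_k\}_{k=1}^\infty$ of nonnegative real numbers *admissible* if $$a_{2j-1}\ \ge\ \frac{2j}{2j-1}\,a_{2j}\qquad\text{and}\qquad a_{2j}\ \ge\ \frac{(2j+1)(4j-1)}{2j(4j+3)}\,a_{2j+1}\qquad\text{for all } j=1,2,\dots$$ If $\{a_k\}$ is admissible, then all partial sums of $\sum a_k\sin(kx)$ are nonnegative on $[0,\pi]$, that is, $$\sum_{k=1}^{n} a_k\sin(kx)\ \ge\ 0\qquad\text{for all } x\in[0,\pi] \text{ and all } n=1,2,3,\dots$$ For real sequences write $\{a_k\}\succeq\{b_k\}$ if $a_k=0$ implies $b_k=0$ and, after skipping the indices with $a_k=0$, the quotients $b_k/a_k$ are nonnegative and non-increasing in $k$. Then the sequence $$\delta_k = 2-\frac{(-1)^k}{k}\qquad(k\ge 1)$$ is maximal among the admissible sequences: it is admissible, and $\{\delta_k\}\succeq\{b_k\}$ for every admissible sequence $\{b_k\}$. It is the only sequence with these two properties, up to multiplication by a positive constant. -/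

import Mathlib

namespace SineSums

/-! Sequences `a₁, a₂, a₃, …` are functions `ℕ → ℝ` of which only the values at `k ≥ 1` matter. -/

/-- The `n`-th partial sum `∑_{k=1}^n a_k sin(kx)`. -/
noncomputable def partialSum (a : ℕ → ℝ) (n : ℕ) (x : ℝ) : ℝ :=
  ∑ k ∈ Finset.Icc 1 n, a k * Real.sin (k * x)

/-- `∑ a_k sin(kx)` is a P-sum in `I`: all its partial sums are nonnegative on `I`. -/
def IsPSum (a : ℕ → ℝ) (I : Set ℝ) : Prop :=
  ∀ n : ℕ, 1 ≤ n → ∀ x ∈ I, 0 ≤ partialSum a n x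

/-- A sequence of nonnegative numbers with Vietoris' condition on the pairs `(2j-1, 2j)` and the
second condition on the pairs `(2j, 2j+1)`. -/
structure Admissible (a : ℕ → ℝ) : Prop where
  nonneg : ∀ k : ℕ, 1 ≤ k → 0 ≤ a k
  vietoris : ∀ j : ℕ, 1 ≤ j → (2 * j : ℝ) / (2 * j - 1) * a (2 * j) ≤ a (2 * j - 1)
  even_odd : ∀ j : ℕ, 1 ≤ j →
    ((2 * j + 1) * (4 * j - 1) : ℝ) / (2 * j * (4 * j + 3)) * a (2 * j + 1) ≤ a (2 * j)

/-- The comparison order `a ⪰ b`: `a_k = 0` implies `b_k = 0`, and, after skipping the indices with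
`a_k = 0`, the quotients `b_k / a_k` are nonnegative and non-increasing. -/
structure Dominates (a b : ℕ → ℝ) : Prop where
  zero_of_zero : ∀ k : ℕ, 1 ≤ k → a k = 0 → b k = 0
  ratio_nonneg : ∀ k : ℕ, 1 ≤ k → a k ≠ 0 → 0 ≤ b k / a k
  ratio_antitone : ∀ k l : ℕ, 1 ≤ k → k ≤ l → a k ≠ 0 → a l ≠ 0 → b l / a l ≤ b k / a k

/-- `a` is maximal among the admissible sequences: it is admissible and dominates each of them. -/
def IsMaximalAdmissible (a : ℕ → ℝ) : Prop :=
  Admissible a ∧ ∀ b : ℕ → ℝ, Admissible b → Dominates a b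

/-- The coefficients `δ_k = 2 - (-1)^k / k`, that is `3, 3/2, 7/3, 7/4, 11/5, 11/6, …`. -/
noncomputable def delta (k : ℕ) : ℝ := 2 - (-1) ^ k / k

end SineSums

/-! The two admissibility conditions say exactly that `a_k / δ_k` is non-increasing; this gives the
maximality of `δ`, and summation by parts reduces the nonnegativity of the partial sums of an
admissible sequence to that of the partial sums of `δ`.

At `x = π - 2h` the alternating signs in `δ_k` and in `sin (k x)` cancel. With
`F_n(h) = ∑_{k ≤ n} sin(2kh) / k`, multiplying the `n`-th partial sum of `δ` by `cos h` gives
`cos h * F_n(h) + sin h - (-1)^n sin((2n+1)h)`, so it suffices to bound `|sin((2n+1)h)|` by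
`cos h * F_n(h) + sin h`. For `(2n+1)h ≤ π` this holds term by term, because
`k sin h cos(kh) ≤ cos h sin(kh)` as long as `kh ≤ π`. For `(2n+1)h ≥ π`, integrating
`F_n' = sin((2n+1)h) / sin h - 1` by parts on `[h, π/2]` bounds `F_n` below by `π/2 - h` up to an
error of size `1 / ((2n+1) sin h) ≤ 2/5`, which `(π/2 - h) cos h ≥ (π/2) (1 - sin h)` absorbs.
-/

namespace SineSums

open Real Finset

/-! ### The comparison order -/

lemma partialSum_succ (a : ℕ → ℝ) (n : ℕ) (x : ℝ) :
    partialSum a (n + 1) x = partialSum a n x + a (n + 1) * sin ((n + 1) * x) := by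
  rw [partialSum, sum_Icc_succ_top (by lia), Nat.cast_succ, ← partialSum]

section Dominates

variable {a b : ℕ → ℝ}

/-- Quantifying over every lower bound `r` of the quotients lets the induction step over indices
with `a_k = 0`, where there is no quotient. -/
lemma Dominates.mul_partialSum_le (hab : Dominates a b) {x : ℝ}
    (ha : ∀ n, 1 ≤ n → 0 ≤ partialSum a n x) (n : ℕ) {r : ℝ}
    (hr : ∀ k, 1 ≤ k → k ≤ n → a k ≠ 0 → r ≤ b k / a k) :
    r * partialSum a n x ≤ partialSum b n x := by
  induction n generalizing r with
  | zero => simp [partialSum]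
  | succ n ih =>
    have hn : 1 ≤ n + 1 := n.succ_pos
    by_cases h0 : a (n + 1) = 0
    · rw [partialSum_succ, partialSum_succ, h0, hab.zero_of_zero _ hn h0, zero_mul, add_zero,
        add_zero]
      exact ih fun k hk hkn => hr k hk (hkn.trans n.le_succ)
    · set q := b (n + 1) / a (n + 1)
      have hqb : q * a (n + 1) = b (n + 1) := div_mul_cancel₀ _ h0
      have hqn : q * partialSum a n x ≤ partialSum b n x :=
        ih fun k hk hkn hk0 => hab.ratio_antitone k _ hk (hkn.trans n.le_succ) hk0 h0
      calc r * partialSum a (n + 1) x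
          ≤ q * partialSum a (n + 1) x :=
            mul_le_mul_of_nonneg_right (hr _ hn le_rfl h0) (ha _ hn)
        _ = q * partialSum a n x + b (n + 1) * sin ((n + 1) * x) := by
            rw [partialSum_succ, mul_add, ← mul_assoc, hqb]
        _ ≤ partialSum b (n + 1) x := by rw [partialSum_succ]; gcongr

lemma Dominates.isPSum (hab : Dominates a b) {I : Set ℝ} (ha : IsPSum a I) : IsPSum b I :=
  fun n _ x hx => by
    simpa only [zero_mul] using hab.mul_partialSum_le (fun m hm => ha m hm x hx) n
      fun k hk _ hk0 => hab.ratio_nonneg k hk hk0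

lemma Dominates.div_eq_div (hab : Dominates a b) (hba : Dominates b a) {k l : ℕ} (hk : 1 ≤ k)
    (hl : 1 ≤ l) (hak : a k ≠ 0) (hal : a l ≠ 0) : b k / a k = b l / a l := by
  wlog hkl : k ≤ l generalizing k l
  · exact (this hl hk hal hak (le_of_not_ge hkl)).symm
  have hbk : b k ≠ 0 := mt (hba.zero_of_zero k hk) hak
  have hbl : b l ≠ 0 := mt (hba.zero_of_zero l hl) hal
  have hpos : 0 < a k / b k := (hba.ratio_nonneg k hk hbk).lt_of_ne' (div_ne_zero hak hbk)
  have hpos' : 0 < a l / b l := (hba.ratio_nonneg l hl hbl).lt_of_ne' (div_ne_zero hal hbl)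
  refine le_antisymm ?_ (hab.ratio_antitone k l hk hkl hak hal)
  rw [← inv_div (a k), ← inv_div (a l), inv_le_inv₀ hpos hpos']
  exact hba.ratio_antitone k l hk hkl hbk hbl

lemma Dominates.exists_eq_const_mul (hab : Dominates a b) (hba : Dominates b a) :
    ∃ c : ℝ, 0 < c ∧ ∀ k : ℕ, 1 ≤ k → b k = c * a k := by
  by_cases h : ∃ l, 1 ≤ l ∧ a l ≠ 0
  · obtain ⟨l, hl, hal⟩ := h
    have hbl : b l ≠ 0 := mt (hba.zero_of_zero l hl) hal
    refine ⟨b l / a l, (hab.ratio_nonneg l hl hal).lt_of_ne' (div_ne_zero hbl hal), fun k hk => ?_⟩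
    by_cases hak : a k = 0
    · rw [hab.zero_of_zero k hk hak, hak, mul_zero]
    · rw [hab.div_eq_div hba hl hk hal hak, div_mul_cancel₀ _ hak]
  · push Not at h
    exact ⟨1, one_pos, fun k hk => by rw [hab.zero_of_zero k hk (h k hk), h k hk, mul_zero]⟩

lemma IsMaximalAdmissible.exists_eq_const_mul (ha : IsMaximalAdmissible a)
    (hb : IsMaximalAdmissible b) : ∃ c : ℝ, 0 < c ∧ ∀ k : ℕ, 1 ≤ k → b k = c * a k :=
  (ha.2 b hb.1).exists_eq_const_mul (hb.2 a ha.1)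

end Dominates

/-! ### Maximality of `delta` -/

lemma delta_pos (k : ℕ) : 0 < delta k := by
  have h : (-1 : ℝ) ^ k / k ≤ 1 :=
    calc (-1 : ℝ) ^ k / k ≤ |(-1 : ℝ) ^ k / k| := le_abs_self _
      _ = (k : ℝ)⁻¹ := by rw [abs_div, abs_neg_one_pow, Nat.abs_cast, one_div]
      _ ≤ 1 := Nat.cast_inv_le_one k
  rw [delta]
  linarith

lemma delta_two_mul_add_one (j : ℕ) : delta (2 * j + 1) = (4 * j + 3) / (2 * j + 1) := by
  rw [delta, (odd_two_mul_add_one j).neg_one_pow]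
  push_cast
  field_simp
  ring

lemma delta_two_mul {j : ℕ} (hj : 1 ≤ j) : delta (2 * j) = (4 * j - 1) / (2 * j) := by
  have hj0 : (j : ℝ) ≠ 0 := Nat.cast_ne_zero.2 (by lia)
  rw [delta, (even_two_mul j).neg_one_pow]
  push_cast
  field_simp
  ring

lemma delta_two_mul_sub_one {j : ℕ} (hj : 1 ≤ j) :
    delta (2 * j - 1) = (4 * j - 1) / (2 * j - 1) := by
  obtain ⟨i, rfl⟩ := Nat.exists_eq_add_of_le' hj
  rw [show 2 * (i + 1) - 1 = 2 * i + 1 by lia, delta_two_mul_add_one]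
  push_cast
  congr 1 <;> ring

lemma delta_two_mul_sub_one_div_delta {j : ℕ} (hj : 1 ≤ j) :
    delta (2 * j - 1) / delta (2 * j) = 2 * j / (2 * j - 1) := by
  have hj1 : (1 : ℝ) ≤ j := Nat.one_le_cast.2 hj
  have hnum : (4 * j - 1 : ℝ) ≠ 0 := by linarith
  rw [delta_two_mul_sub_one hj, delta_two_mul hj]
  field_simp

lemma delta_two_mul_div_delta {j : ℕ} (hj : 1 ≤ j) :
    delta (2 * j) / delta (2 * j + 1) =
      (2 * j + 1) * (4 * j - 1) / (2 * j * (4 * j + 3)) := by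
  rw [delta_two_mul hj, delta_two_mul_add_one]
  field_simp

lemma admissible_iff {a : ℕ → ℝ} :
    Admissible a ↔ (∀ k, 1 ≤ k → 0 ≤ a k) ∧
      ∀ k, 1 ≤ k → a (k + 1) / delta (k + 1) ≤ a k / delta k := by
  have hdiv (k l : ℕ) : a l / delta l ≤ a k / delta k ↔ delta k / delta l * a l ≤ a k := by
    rw [le_div_iff₀ (delta_pos k), div_mul_comm, div_mul_comm (delta k), mul_comm]
  have hpred {j : ℕ} (hj : 1 ≤ j) : 2 * j - 1 + 1 = 2 * j := by lia
  constructor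
  · refine fun ha => ⟨ha.nonneg, fun k hk => ?_⟩
    obtain ⟨j, hj, rfl | rfl⟩ : ∃ j, 1 ≤ j ∧ (k = 2 * j - 1 ∨ k = 2 * j) :=
      ⟨(k + 1) / 2, by lia, by lia⟩
    · rw [hpred hj, hdiv, delta_two_mul_sub_one_div_delta hj]
      exact ha.vietoris j hj
    · rw [hdiv, delta_two_mul_div_delta hj]
      exact ha.even_odd j hj
  · rintro ⟨hnonneg, hanti⟩
    refine ⟨hnonneg, fun j hj => ?_, fun j hj => ?_⟩
    · rw [← delta_two_mul_sub_one_div_delta hj, ← hdiv]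
      simpa only [hpred hj] using hanti (2 * j - 1) (by lia)
    · rw [← delta_two_mul_div_delta hj, ← hdiv]
      exact hanti (2 * j) (by lia)

lemma Admissible.div_delta_le {a : ℕ → ℝ} (ha : Admissible a) {k l : ℕ} (hk : 1 ≤ k)
    (hkl : k ≤ l) : a l / delta l ≤ a k / delta k := by
  induction l, hkl using Nat.le_induction with
  | base => exact le_rfl
  | succ l hl ih => exact ((admissible_iff.1 ha).2 l (hk.trans hl)).trans ih

lemma Admissible.dominates_delta {a : ℕ → ℝ} (ha : Admissible a) : Dominates delta a where
  zero_of_zero k _ h := absurd h (delta_pos k).ne'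
  ratio_nonneg k hk _ := div_nonneg (ha.nonneg k hk) (delta_pos k).le
  ratio_antitone _ _ hk hkl _ _ := ha.div_delta_le hk hkl

lemma admissible_delta : Admissible delta :=
  admissible_iff.2 ⟨fun k _ => (delta_pos k).le, fun k _ => by
    rw [div_self (delta_pos k).ne', div_self (delta_pos (k + 1)).ne']⟩

lemma isMaximalAdmissible_delta : IsMaximalAdmissible delta :=
  ⟨admissible_delta, fun _ hb => hb.dominates_delta⟩

/-! ### Elementary trigonometric inequalities -/

lemma mul_sin_le_sin_mul {c x : ℝ} (hc0 : 0 ≤ c) (hc1 : c ≤ 1) (hx0 : 0 ≤ x) (hxπ : x ≤ π) :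
    c * sin x ≤ sin (c * x) := by
  simpa using strictConcaveOn_sin_Icc.concaveOn.2 (Set.left_mem_Icc.2 pi_pos.le) ⟨hx0, hxπ⟩
    (sub_nonneg.2 hc1) hc0 (sub_add_cancel 1 c)

lemma convexOn_tan : ConvexOn ℝ (Set.Ico 0 (π / 2)) tan := by
  have hcos : ∀ x ∈ Set.Ico 0 (π / 2), 0 < cos x := fun x hx =>
    cos_pos_of_mem_Ioo ⟨by linarith [hx.1, pi_pos], hx.2⟩
  refine MonotoneOn.convexOn_of_deriv (convex_Ico _ _)
    (fun x hx => (continuousAt_tan.2 (hcos x hx).ne').continuousWithinAt)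
    (fun x hx => (differentiableAt_tan.2
      (hcos x (interior_subset hx)).ne').differentiableWithinAt) fun x hx y hy hxy => ?_
  have hy' := hcos y (interior_subset hy)
  rw [interior_Ico] at hx hy
  have hle : cos y ≤ cos x := cos_le_cos_of_nonneg_of_le_pi hx.1.le (by linarith [hy.2, pi_pos]) hxy
  rw [deriv_tan, deriv_tan]
  gcongr

lemma tan_mul_le_mul_tan {c x : ℝ} (hc0 : 0 ≤ c) (hc1 : c ≤ 1) (hx0 : 0 ≤ x) (hx : x < π / 2) :
    tan (c * x) ≤ c * tan x := by
  simpa using convexOn_tan.2 (Set.left_mem_Ico.2 pi_div_two_pos) ⟨hx0, hx⟩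
    (sub_nonneg.2 hc1) hc0 (sub_add_cancel 1 c)

lemma pi_div_two_mul_one_sub_cos_le {x : ℝ} (hx0 : 0 ≤ x) (hx : x ≤ π / 2) :
    π / 2 * (1 - cos x) ≤ x * sin x := by
  have hpi := pi_pos
  have htan : tan (x / 2) ≤ 2 * x / π := by
    have h := tan_mul_le_mul_tan (c := 2 * x / π) (x := π / 4) (by positivity)
      (by rw [div_le_one hpi]; linarith) (by positivity) (by linarith)
    rwa [tan_pi_div_four, mul_one, show 2 * x / π * (π / 4) = x / 2 by field_simp; ring] at h
  have hsin : 0 ≤ sin x := sin_nonneg_of_nonneg_of_le_pi hx0 (by linarith)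
  have hcos : cos (x / 2) ≠ 0 :=
    (cos_pos_of_mem_Ioo ⟨by linarith, by linarith⟩).ne'
  have hhalf : 1 - cos x = tan (x / 2) * sin x := by
    rw [show x = 2 * (x / 2) by ring, sin_two_mul, cos_two_mul',
      mul_div_cancel_left₀ _ two_ne_zero, tan_eq_sin_div_cos]
    field_simp
    linear_combination -sin_sq_add_cos_sq (x / 2)
  calc π / 2 * (1 - cos x) = π / 2 * (tan (x / 2) * sin x) := by rw [hhalf]
    _ ≤ π / 2 * (2 * x / π * sin x) := by gcongr
    _ = x * sin x := by field_simp

lemma mul_sin_pi_div_le_mul_sin {m M h : ℝ} (hm : 1 ≤ m) (hmM : m ≤ M) (hπ : π ≤ M * h)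
    (h2 : h ≤ π / 2) : m * sin (π / m) ≤ M * sin h := by
  have hm0 : 0 < m := by linarith
  have hM : 0 < M := by linarith
  have hchord : m / M * sin (π / m) ≤ sin (π / M) := by
    have := mul_sin_le_sin_mul (div_nonneg hm0.le hM.le) ((div_le_one hM).2 hmM)
      (div_nonneg pi_pos.le hm0.le) (div_le_self pi_pos.le hm)
    rwa [show m / M * (π / m) = π / M by field_simp] at this
  have hmono : sin (π / M) ≤ sin h :=
    sin_le_sin_of_le_of_le_pi_div_two (by linarith [pi_pos, div_pos pi_pos hM]) h2
      ((div_le_iff₀' hM).2 hπ)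
  calc m * sin (π / m) = M * (m / M * sin (π / m)) := by field_simp
    _ ≤ M * sin h := mul_le_mul_of_nonneg_left (hchord.trans hmono) hM.le

lemma five_halves_le_mul_sin {M h : ℝ} (hM : 3 ≤ M) (hπ : π ≤ M * h) (h2 : h ≤ π / 2) :
    5 / 2 ≤ M * sin h := by
  have hsqrt : (5 / 3 : ℝ) ≤ √3 := le_sqrt_of_sq_le (by norm_num)
  have h := mul_sin_pi_div_le_mul_sin (by norm_num) hM hπ h2
  rw [sin_pi_div_three] at h
  linarith

lemma nat_mul_sin_mul_cos_le {h : ℝ} (h0 : 0 ≤ h) (h2 : h ≤ π / 2) {k : ℕ} (hk : k * h ≤ π) :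
    k * (sin h * cos (k * h)) ≤ cos h * sin (k * h) := by
  induction k with
  | zero => simp
  | succ k ih =>
    push_cast at hk ⊢
    have hkh : k * h ≤ π := by linarith
    have hcos : 0 ≤ cos h := cos_nonneg_of_neg_pi_div_two_le_of_le (by linarith [pi_pos]) h2
    have hsin : 0 ≤ sin (k * h) := sin_nonneg_of_nonneg_of_le_pi (by positivity) hkh
    have hstep : cos h * sin ((k + 1) * h) - (k + 1) * (sin h * cos ((k + 1) * h)) =
        cos h * (cos h * sin (k * h) - k * (sin h * cos (k * h))) +
          (k + 1) * sin h ^ 2 * sin (k * h) := by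
      rw [add_one_mul, sin_add, cos_add]
      ring
    have hpos := mul_nonneg hcos (sub_nonneg.2 (ih hkh))
    rw [← sub_nonneg, hstep]
    positivity

/-! ### Fejér–Jackson sums -/

/-- The Fejér–Jackson sum `∑_{k=1}^n sin(kx) / k` at `x = 2h`, to which the partial sums of `delta`
reduce. The half angle `h` is the variable of the Dirichlet kernel `sin((2n+1)h) / sin h`. -/
noncomputable def fejerJackson (n : ℕ) (h : ℝ) : ℝ :=
  ∑ k ∈ Icc 1 n, sin (2 * k * h) / k

lemma sin_mul_sum_two_mul_cos (n : ℕ) (h : ℝ) :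
    sin h * ∑ k ∈ Icc 1 n, 2 * cos (2 * k * h) = sin ((2 * n + 1) * h) - sin h := by
  induction n with
  | zero => simp
  | succ n ih =>
    have hstep := two_mul_sin_mul_cos h (2 * (n + 1) * h)
    rw [show h - 2 * (n + 1) * h = -((2 * n + 1) * h) by ring, sin_neg,
      show h + 2 * (n + 1) * h = (2 * (n + 1) + 1) * h by ring] at hstep
    rw [sum_Icc_succ_top (by lia), mul_add, ih]
    push_cast
    linarith

lemma cos_mul_sum_alternating_two_mul_sin (n : ℕ) (h : ℝ) :
    cos h * ∑ k ∈ Icc 1 n, (-1) ^ k * (2 * sin (2 * k * h)) =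
      (-1) ^ n * sin ((2 * n + 1) * h) - sin h := by
  induction n with
  | zero => simp
  | succ n ih =>
    have hstep := two_mul_sin_mul_cos (2 * (n + 1) * h) h
    rw [show 2 * (n + 1) * h - h = (2 * n + 1) * h by ring,
      show 2 * (n + 1) * h + h = (2 * (n + 1) + 1) * h by ring] at hstep
    rw [sum_Icc_succ_top (by lia), mul_add, ih, pow_succ]
    push_cast
    linear_combination -(-1) ^ n * hstep

lemma partialSum_delta_pi_sub (n : ℕ) (h : ℝ) :
    partialSum delta n (π - 2 * h) =
      fejerJackson n h - ∑ k ∈ Icc 1 n, (-1) ^ k * (2 * sin (2 * k * h)) := by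
  rw [partialSum, fejerJackson, ← sum_sub_distrib]
  refine sum_congr rfl fun k _ => ?_
  have hsq : ((-1 : ℝ) ^ k) ^ 2 = 1 := by rw [← pow_mul, mul_comm, pow_mul, neg_one_sq, one_pow]
  rw [show (k : ℝ) * (π - 2 * h) = k * π - 2 * k * h by ring, sin_nat_mul_pi_sub, delta]
  linear_combination sin (2 * k * h) / k * hsq

lemma cos_mul_partialSum_delta_pi_sub (n : ℕ) (h : ℝ) :
    cos h * partialSum delta n (π - 2 * h) =
      cos h * fejerJackson n h + sin h - (-1) ^ n * sin ((2 * n + 1) * h) := by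
  rw [partialSum_delta_pi_sub, mul_sub, cos_mul_sum_alternating_two_mul_sin]
  ring

lemma hasDerivAt_fejerJackson (n : ℕ) {h : ℝ} (hh : sin h ≠ 0) :
    HasDerivAt (fejerJackson n) (sin ((2 * n + 1) * h) / sin h - 1) h := by
  have hsum : HasDerivAt (fejerJackson n) (∑ k ∈ Icc 1 n, 2 * cos (2 * k * h)) h := by
    refine HasDerivAt.fun_sum fun k hk => ?_
    have hk0 : (k : ℝ) ≠ 0 := Nat.cast_ne_zero.2 (Nat.one_le_iff_ne_zero.1 (mem_Icc.1 hk).1)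
    refine ((((hasDerivAt_id h).const_mul (2 * (k : ℝ))).sin).div_const (k : ℝ)).congr_deriv ?_
    simp only [id]
    field_simp
  refine hsum.congr_deriv ?_
  rw [eq_sub_iff_add_eq, eq_div_iff hh]
  linarith [sin_mul_sum_two_mul_cos n h]

lemma fejerJackson_pi_div_two (n : ℕ) : fejerJackson n (π / 2) = 0 :=
  sum_eq_zero fun k _ => by
    rw [show 2 * (k : ℝ) * (π / 2) = k * π by ring, sin_nat_mul_pi, zero_div]

/-- The Fejér–Jackson sum corrected so as to become decreasing on `(0, π/2]`: the term `h` cancels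
the constant in its derivative, and the quotient is the boundary term of the integration by parts of
the Dirichlet kernel, with `1 + cos` as the antiderivative because it has constant sign. -/
noncomputable def correctedFejerJackson (n : ℕ) (h : ℝ) : ℝ :=
  fejerJackson n h + h + (1 + cos ((2 * n + 1) * h)) / ((2 * n + 1) * sin h)

lemma hasDerivAt_correctedFejerJackson (n : ℕ) {h : ℝ} (hh : sin h ≠ 0) :
    HasDerivAt (correctedFejerJackson n)
      (-((1 + cos ((2 * n + 1) * h)) * cos h / ((2 * n + 1) * sin h ^ 2))) h := by
  have hM : (2 * n + 1 : ℝ) ≠ 0 := by positivity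
  have hcos : HasDerivAt (fun x => 1 + cos ((2 * n + 1) * x))
      (-((2 * n + 1) * sin ((2 * n + 1) * h))) h := by
    refine (((hasDerivAt_id h).const_mul (2 * n + 1 : ℝ)).cos.const_add 1).congr_deriv ?_
    simp only [id]
    ring
  refine (((hasDerivAt_fejerJackson n hh).add (hasDerivAt_id h)).add
    (hcos.div ((hasDerivAt_sin h).const_mul _) (mul_ne_zero hM hh))).congr_deriv ?_
  field_simp
  ring

lemma antitoneOn_correctedFejerJackson (n : ℕ) :
    AntitoneOn (correctedFejerJackson n) (Set.Ioc 0 (π / 2)) := by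
  have hderiv := fun x (hx : x ∈ Set.Ioc 0 (π / 2)) => hasDerivAt_correctedFejerJackson n
    (sin_pos_of_pos_of_lt_pi hx.1 (by linarith [hx.2, pi_pos])).ne'
  refine antitoneOn_of_deriv_nonpos (convex_Ioc _ _)
    (fun x hx => (hderiv x hx).continuousAt.continuousWithinAt)
    (fun x hx => (hderiv x (interior_subset hx)).differentiableAt.differentiableWithinAt)
    fun x hx => ?_
  have hx := interior_subset hx
  rw [(hderiv x hx).deriv, neg_nonpos]
  have hcos : 0 ≤ cos x := cos_nonneg_of_neg_pi_div_two_le_of_le (by linarith [hx.1, pi_pos]) hx.2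
  have hone : 0 ≤ 1 + cos ((2 * n + 1) * x) := by linarith [neg_one_le_cos ((2 * n + 1) * x)]
  positivity

lemma correctedFejerJackson_pi_div_two (n : ℕ) :
    correctedFejerJackson n (π / 2) = π / 2 + (2 * n + 1 : ℝ)⁻¹ := by
  have hcos : cos ((2 * n + 1) * (π / 2)) = 0 := by
    rw [show (2 * n + 1 : ℝ) * (π / 2) = n * π + π / 2 by ring, cos_add_pi_div_two,
      sin_nat_mul_pi, neg_zero]
  rw [correctedFejerJackson, fejerJackson_pi_div_two, hcos, sin_pi_div_two, zero_add, add_zero,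
    mul_one, one_div]

lemma le_fejerJackson (n : ℕ) {h : ℝ} (h0 : 0 < h) (h2 : h ≤ π / 2) :
    π / 2 - h - (1 - sin h + cos ((2 * n + 1) * h)) * ((2 * n + 1) * sin h)⁻¹ ≤
      fejerJackson n h := by
  have hsin : 0 < sin h := sin_pos_of_pos_of_lt_pi h0 (by linarith [pi_pos])
  have hinv : (2 * n + 1 : ℝ)⁻¹ = sin h * ((2 * n + 1) * sin h)⁻¹ := by field_simp
  have hanti := antitoneOn_correctedFejerJackson n ⟨h0, h2⟩ ⟨pi_div_two_pos, le_rfl⟩ h2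
  rw [correctedFejerJackson_pi_div_two, correctedFejerJackson, hinv, div_eq_mul_inv (1 + _)]
    at hanti
  linarith

/-! ### Nonnegativity of the partial sums -/

lemma sin_le_cos_mul_fejerJackson_add_sin {n : ℕ} {h : ℝ} (h0 : 0 ≤ h) (h2 : h ≤ π / 2)
    (hπ : 2 * n * h ≤ π) : sin ((2 * n + 1) * h) ≤ cos h * fejerJackson n h + sin h := by
  rw [← sub_le_iff_le_add, ← sin_mul_sum_two_mul_cos, fejerJackson, mul_sum, mul_sum]
  refine sum_le_sum fun k hk => ?_
  obtain ⟨hk1, hkn⟩ := mem_Icc.1 hk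
  have hk0 : (0 : ℝ) < k := Nat.cast_pos.2 hk1
  have hkπ : 2 * k * h ≤ π := le_trans (by gcongr) hπ
  have hterm := nat_mul_sin_mul_cos_le (k := 2 * k) h0 h2 (by exact_mod_cast hkπ)
  push_cast at hterm
  rw [mul_div_assoc', le_div_iff₀ hk0]
  linarith

lemma one_sub_sq_div_two_le_cos_mul_add_sin {h c z : ℝ} (h0 : 0 ≤ h) (h2 : h ≤ π / 2)
    (hz0 : 0 ≤ z) (hz : z ≤ 2 / 5) :
    1 - c ^ 2 / 2 ≤ cos h * (π / 2 - h - (1 - sin h + c) * z) + sin h := by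
  have hsin1 : 0 ≤ 1 - sin h := sub_nonneg.2 (sin_le_one h)
  have hmain : 3.14 / 2 * (1 - sin h) ≤ (π / 2 - h) * cos h :=
    calc 3.14 / 2 * (1 - sin h) ≤ π / 2 * (1 - sin h) := by gcongr; exact pi_gt_d2.le
      _ ≤ (π / 2 - h) * cos h := by
        simpa only [cos_pi_div_two_sub, sin_pi_div_two_sub] using
          pi_div_two_mul_one_sub_cos_le (x := π / 2 - h) (by linarith) (by linarith)
  have hlin : cos h * ((1 - sin h) * z) ≤ 1 * ((1 - sin h) * (2 / 5)) :=
    mul_le_mul (cos_le_one h) (mul_le_mul_of_nonneg_left hz hsin1) (mul_nonneg hsin1 hz0)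
      zero_le_one
  have hquad : cos h * (c * z) ≤ c ^ 2 / 2 + 4 / 25 * (1 - sin h) := by
    have hzsq : cos h ^ 2 * z ^ 2 ≤ cos h ^ 2 * (2 / 5) ^ 2 := by gcongr
    have hcsq : cos h ^ 2 ≤ 2 * (1 - sin h) := by
      linarith [sin_sq_add_cos_sq h, sq_nonneg (1 - sin h)]
    linarith [two_mul_le_add_sq c (cos h * z)]
  linarith

lemma le_cos_mul_fejerJackson_add_sin {n : ℕ} {h s : ℝ} (h2 : h ≤ π / 2)
    (hπ : π ≤ (2 * n + 1) * h) (hs : s ^ 2 + cos ((2 * n + 1) * h) ^ 2 = 1) :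
    s ≤ cos h * fejerJackson n h + sin h := by
  have hpi := pi_pos
  have h0 : 0 < h := pos_of_mul_pos_right (hpi.trans_le hπ) (by positivity)
  have hn : (1 : ℝ) ≤ n := by
    rw [Nat.one_le_cast, Nat.one_le_iff_ne_zero]
    rintro rfl
    norm_num at hπ
    linarith
  have hcos : 0 ≤ cos h := cos_nonneg_of_neg_pi_div_two_le_of_le (by linarith) h2
  have hsin : 0 < sin h := sin_pos_of_pos_of_lt_pi h0 (by linarith)
  have hinv : ((2 * n + 1) * sin h)⁻¹ ≤ 2 / 5 :=
    inv_le_of_inv_le₀ (by norm_num) (by linarith [five_halves_le_mul_sin (by linarith) hπ h2])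
  calc s ≤ 1 - cos ((2 * n + 1) * h) ^ 2 / 2 := by linarith [two_mul_le_add_sq s 1]
    _ ≤ cos h * (π / 2 - h - (1 - sin h + cos ((2 * n + 1) * h)) * ((2 * n + 1) * sin h)⁻¹) +
          sin h := one_sub_sq_div_two_le_cos_mul_add_sin h0.le h2 (by positivity) hinv
    _ ≤ cos h * fejerJackson n h + sin h :=
      add_le_add_left (mul_le_mul_of_nonneg_left (le_fejerJackson n h0 h2) hcos) _

lemma abs_sin_le_cos_mul_fejerJackson_add_sin (n : ℕ) {h : ℝ} (h0 : 0 ≤ h) (h2 : h ≤ π / 2) :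
    |sin ((2 * n + 1) * h)| ≤ cos h * fejerJackson n h + sin h := by
  rcases le_total ((2 * n + 1) * h) π with hπ | hπ
  · rw [abs_of_nonneg (sin_nonneg_of_nonneg_of_le_pi (by positivity) hπ)]
    exact sin_le_cos_mul_fejerJackson_add_sin h0 h2 (by linarith)
  · exact le_cos_mul_fejerJackson_add_sin h2 hπ (by rw [sq_abs, sin_sq_add_cos_sq])

lemma isPSum_delta : IsPSum delta (Set.Icc 0 π) := by
  rintro n - x ⟨hx0, hxπ⟩
  rcases hx0.eq_or_lt with rfl | hx0
  · simp [partialSum]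
  obtain ⟨h, rfl⟩ : ∃ h, x = π - 2 * h := ⟨(π - x) / 2, by ring⟩
  have hcos : 0 < cos h := cos_pos_of_mem_Ioo ⟨by linarith [pi_pos], by linarith⟩
  refine nonneg_of_mul_nonneg_right ?_ hcos
  rw [cos_mul_partialSum_delta_pi_sub, sub_nonneg]
  calc (-1) ^ n * sin ((2 * n + 1) * h)
      ≤ |(-1) ^ n * sin ((2 * n + 1) * h)| := le_abs_self _
    _ = |sin ((2 * n + 1) * h)| := by rw [abs_mul, abs_neg_one_pow, one_mul]
    _ ≤ cos h * fejerJackson n h + sin h :=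
      abs_sin_le_cos_mul_fejerJackson_add_sin n (by linarith) (by linarith)

lemma Admissible.isPSum {a : ℕ → ℝ} (ha : Admissible a) : IsPSum a (Set.Icc 0 π) :=
  ha.dominates_delta.isPSum isPSum_delta

end SineSums

theorem theorem2 :
    (∀ a : ℕ → ℝ, SineSums.Admissible a → SineSums.IsPSum a (Set.Icc 0 Real.pi)) ∧
    SineSums.IsMaximalAdmissible SineSums.delta ∧
    (∀ e : ℕ → ℝ, SineSums.IsMaximalAdmissible e →
      ∃ c : ℝ, 0 < c ∧ ∀ k : ℕ, 1 ≤ k → e k = c * SineSums.delta k) :=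
  ⟨fun _ ha => ha.isPSum, SineSums.isMaximalAdmissible_delta,
    fun _ he => SineSums.isMaximalAdmissible_delta.exists_eq_const_mul he⟩
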